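/- All algebras are commutative, associative and unital. For a prime power $q$ and an integer $n\ge 0$, let $N(q,n)$ be the number of isomorphism classes of $\mathbb{F}_q$-algebras that have dimension $n$ as $\mathbb{F}_q$-vector spaces; this number is finite. **Theorem.** One has $N(q,n)=q^{\frac{2}{27}n^3+O(n^{8/3})}$ with an implied constant that is independent of $q$. That is, there is an absolute constant $C>0$ such that for every prime power $q$ and every integer $n\ge 0$, $$q^{\frac{2}{27}n^3-Cn^{8/3}}\;\le\;N(q,n)\;\le\;q^{\frac{2}{27}n^3+Cn^{8/3}}.$$ -/

import Mathlib

universe u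

/-- The commutative, associative, unital algebras of rank `n` over the field `F`, i.e. those that
are `n`-dimensional as `F`-vector spaces. -/
def RankAlgebra (F : Type u) [Field F] (n : ℕ) : Type (u + 1) :=
  {A : CommAlgCat.{u} F // Module.Finite F A ∧ Module.finrank F A = n}

/-- Two rank-`n` algebras are identified when they are isomorphic as `F`-algebras. -/
def rankAlgebraSetoid (F : Type u) [Field F] (n : ℕ) : Setoid (RankAlgebra F n) where
  r A B := Nonempty (A.1 ≃ₐ[F] B.1)
  iseqv :=
    { refl := fun _ => ⟨AlgEquiv.refl⟩
      symm := fun ⟨e⟩ => ⟨e.symm⟩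
      trans := fun ⟨e⟩ ⟨f⟩ => ⟨e.trans f⟩ }

/-- The type of isomorphism classes of commutative `F`-algebras of rank `n`. -/
def RankAlgebraClasses (F : Type u) [Field F] (n : ℕ) : Type (u + 1) :=
  Quotient (rankAlgebraSetoid F n)

open Module


/-! Upper bound. Let `N` be the nilradical of an algebra `A` of dimension `n`. Choose greedily at
most `n / (s + 1)` elements `u` of `N` such that, with `I = ∑ u N`, every `v N` has image of
dimension at most `s` in `N / I`. Let `C` be a complement of `I` in `N`, `D = dim C`, `m = dim I`.
Multiplication by the `u` and by `O(log n)` generators of `A` modulo `N` costs `n ^ 2` scalars per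
operator. As `N = C + ∑ u N` is nilpotent, `1` and `C` generate `A` under these operators, so only
the products `C × C` remain to be recorded. Their components modulo `I` cost `2 s D ^ 2` scalars by
the choice of the `u`. Their components in `I` cost `m D (D + 1) / 2`, which is at most `2 n ^ 3 /
27 + n ^ 2` because `D + m ≤ n`. The error is `O(n ^ 3 / s + s n ^ 2 + n ^ 2 log n)`, and `s ≈ n ^
(1/3)` suffices. See `exists_encodes` and `AlgebraDatum.Encodes.nonempty_algEquiv`.

Lower bound. Any symmetric bilinear map `F ^ d × F ^ d → F ^ e` makes `F × F ^ d × F ^ e` an algebra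
in which triple products from `F ^ d × F ^ e` vanish. At most `q ^ (n ^ 2)` maps give the same
class, and `d ≈ 2 n / 3`, `e ≈ n / 3` gives the same main term. -/

/-! ### Greedy choice of subspaces -/

/-- A greedy choice: finitely many of the subspaces `f v` have a sum that no other one enlarges by
more than `s` dimensions. -/
theorem exists_finset_finrank_sup_le {F M α : Type*} [Field F] [AddCommGroup M] [Module F M]
    [FiniteDimensional F M] (f : α → Submodule F M) (s : ℕ) :
    ∃ U : Finset α, U.card * (s + 1) ≤ finrank F M ∧
      ∀ v, finrank F ↥(U.sup f ⊔ f v) ≤ finrank F ↥(U.sup f) + s := by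
  classical
  -- Here `k` bounds the codimension of the sum. Each new `v` adds at least `s + 1` dimensions,
  -- which preserves the bound on `U.card`.
  suffices H : ∀ (k : ℕ) (U : Finset α), U.card * (s + 1) ≤ finrank F ↥(U.sup f) →
      finrank F M ≤ finrank F ↥(U.sup f) + k →
      ∃ U : Finset α, U.card * (s + 1) ≤ finrank F M ∧
        ∀ v, finrank F ↥(U.sup f ⊔ f v) ≤ finrank F ↥(U.sup f) + s from
    H (finrank F M) ∅ (by simp) (by simp)
  intro k
  induction k with
  | zero =>
    intro U hU hk
    exact ⟨U, hU.trans (Submodule.finrank_le _), fun v => by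
      have := Submodule.finrank_le (U.sup f ⊔ f v)
      omega⟩
  | succ k ih =>
    intro U hU hk
    by_cases h : ∀ v, finrank F ↥(U.sup f ⊔ f v) ≤ finrank F ↥(U.sup f) + s
    · exact ⟨U, hU.trans (Submodule.finrank_le _), h⟩
    · push Not at h
      obtain ⟨v, hv⟩ := h
      have e : (insert v U).sup f = U.sup f ⊔ f v := by rw [Finset.sup_insert, sup_comm]
      refine ih (insert v U) ?_ ?_
      · rw [e]
        have := Nat.mul_le_mul_right (s + 1) (Finset.card_insert_le v U)
        rw [add_mul, one_mul] at this
        omega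
      · rw [e]; omega

theorem exists_le_span_range_of_finrank_le {F V : Type*} [Field F] [AddCommGroup V] [Module F V]
    (W : Submodule F V) [FiniteDimensional F W] {s : ℕ} (h : finrank F W ≤ s) :
    ∃ w : Fin s → V, W ≤ Submodule.span F (Set.range w) := by
  refine ⟨fun i => if hi : i.1 < finrank F W then (finBasis F W ⟨i, hi⟩ : V) else 0, ?_⟩
  have hb : Submodule.span F (Set.range fun i => (finBasis F W i : V)) = W := by
    rw [show (fun i => (finBasis F W i : V)) = W.subtype ∘ finBasis F W from rfl,
      Set.range_comp, ← Submodule.map_span, (finBasis F W).span_eq, Submodule.map_top,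
      Submodule.range_subtype]
  conv_lhs => rw [← hb]
  refine Submodule.span_mono ?_
  rintro _ ⟨i, rfl⟩
  exact ⟨⟨i, i.2.trans_le h⟩, by simp⟩

/-- The image of `W` has dimension `dim (ker p + W) - dim (ker p)`. This turns the greedy bound into
`s` spanning vectors. -/
theorem exists_map_le_span_range {F M V : Type*} [Field F] [AddCommGroup M] [Module F M]
    [FiniteDimensional F M] [AddCommGroup V] [Module F V] (p : M →ₗ[F] V) (W : Submodule F M)
    {s : ℕ} (h : finrank F ↥(p.ker ⊔ W) ≤ finrank F p.ker + s) :
    ∃ w : Fin s → V, W.map p ≤ Submodule.span F (Set.range w) := by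
  refine exists_le_span_range_of_finrank_le _ ?_
  have h1 := LinearMap.finrank_range_add_finrank_ker (p.domRestrict (p.ker ⊔ W))
  rw [LinearMap.range_domRestrict, Submodule.map_sup, LinearMap.ker_domRestrict] at h1
  have h2 : p.ker.map p = ⊥ := LinearMap.le_ker_iff_map.1 le_rfl
  have h3 : finrank F ↥(Submodule.comap (p.ker ⊔ W).subtype p.ker) = finrank F p.ker :=
    (Submodule.comapSubtypeEquivOfLe le_sup_left).finrank_eq
  rw [h2, bot_sup_eq] at h1
  change _ + finrank F ↥(Submodule.comap (p.ker ⊔ W).subtype p.ker) = _ at h1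
  omega

/-! ### Generators modulo the nilradical -/

/-- A finite product of at most `2 ^ l` finite extensions of a finite field is generated by `l + 1`
elements. -/
theorem exists_adjoin_pi_eq_top {F J : Type*} [Field F] [Finite F] [Finite J] (k : J → Type*)
    [∀ j, Field (k j)] [∀ j, Algebra F (k j)] [∀ j, FiniteDimensional F (k j)] {l : ℕ}
    (hl : Nat.card J ≤ 2 ^ l) :
    ∃ g : Fin (l + 1) → ∀ j, k j, Algebra.adjoin F (Set.range g) = ⊤ := by
  classical
  have := Fintype.ofFinite J
  have hcard : Fintype.card J ≤ Fintype.card (Fin l → Bool) := by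
    simpa [Nat.card_eq_fintype_card] using hl
  obtain ⟨φ⟩ := Function.Embedding.nonempty_of_card_le hcard
  choose α hα using fun j => Field.exists_primitive_element F (k j)
  -- One generator is primitive in every factor; the other `l` are idempotents reading off the bits
  -- of an injective labelling of the factors.
  refine ⟨Fin.cons α fun t j => if φ j t then 1 else 0, ?_⟩
  set S := Algebra.adjoin F (Set.range (Fin.cons α fun t j => if φ j t then 1 else 0 :
    Fin (l + 1) → ∀ j, k j)) with hS
  have h0 : α ∈ S := Algebra.subset_adjoin ⟨0, rfl⟩
  have h1 : ∀ t, (fun j => if φ j t then 1 else 0 : ∀ j, k j) ∈ S := fun t =>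
    Algebra.subset_adjoin ⟨t.succ, rfl⟩
  have hsingle : ∀ i, (Pi.single i 1 : ∀ j, k j) ∈ S := by
    intro i
    -- The idempotent of factor `i` is cut out by prescribing all bits of its label.
    have e : (Pi.single i 1 : ∀ j, k j) = ∏ t, (if φ i t then
        (fun j => if φ j t then 1 else 0 : ∀ j, k j) else
        1 - (fun j => if φ j t then 1 else 0 : ∀ j, k j)) := by
      funext j
      rw [Finset.prod_apply]
      by_cases hij : j = i
      · subst hij
        rw [Pi.single_eq_same]
        refine (Finset.prod_eq_one fun t _ => ?_).symm
        by_cases h : φ j t <;> simp [h]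
      · rw [Pi.single_eq_of_ne hij]
        obtain ⟨t, ht⟩ : ∃ t, φ j t ≠ φ i t := by
          by_contra! h
          exact hij (φ.injective (funext h))
        refine (Finset.prod_eq_zero (Finset.mem_univ t) ?_).symm
        by_cases h : φ i t <;> by_cases h' : φ j t <;> simp_all
    rw [e]
    refine Subalgebra.prod_mem _ fun t _ => ?_
    split_ifs
    · exact h1 t
    · exact S.sub_mem S.one_mem (h1 t)
  have hsx : ∀ i (x : k i), (Pi.single i x : ∀ j, k j) ∈ S := by
    intro i x
    have hx : x ∈ Algebra.adjoin F {α i} := by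
      rw [← IntermediateField.adjoin_simple_toSubalgebra_of_isAlgebraic
        (Algebra.IsAlgebraic.isAlgebraic _), hα i]
      trivial
    rw [Algebra.adjoin_singleton_eq_range_aeval] at hx
    obtain ⟨P, rfl⟩ := hx
    have e : (Pi.single i (Polynomial.aeval (α i) P) : ∀ j, k j) =
        Pi.single i 1 * Polynomial.aeval α P := by
      funext j
      have hj : Polynomial.aeval α P j = Polynomial.aeval (α j) P :=
        (Polynomial.aeval_algHom_apply (Pi.evalAlgHom F k j) α P).symm
      rw [Pi.mul_apply, hj]
      by_cases hij : j = i
      · subst hij; simp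
      · simp [hij]
    change (Pi.single i (Polynomial.aeval (α i) P) : ∀ j, k j) ∈ S
    rw [e]
    exact S.mul_mem (hsingle i) (Polynomial.aeval_mem_adjoin_singleton F α |> fun h =>
      Algebra.adjoin_le (Set.singleton_subset_iff.2 h0) h)
  refine Algebra.eq_top_iff.2 fun x => ?_
  rw [← Finset.univ_sum_single x]
  exact Subalgebra.sum_mem _ fun i _ => hsx i _

/-- A commutative algebra of dimension at most `2 ^ l` over a finite field is generated modulo its
nilradical by `l + 1` elements. -/
theorem exists_adjoin_sub_mem_nilradical {F A : Type*} [Field F] [Finite F] [CommRing A]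
    [Algebra F A] [FiniteDimensional F A] {l : ℕ} (hl : finrank F A ≤ 2 ^ l) :
    ∃ g : Fin (l + 1) → A, ∀ x, ∃ y ∈ Algebra.adjoin F (Set.range g), x - y ∈ nilradical A := by
  classical
  have : IsArtinianRing A := IsArtinianRing.of_finite F A
  let k : MaximalSpectrum A → Type _ := fun M => A ⧸ M.asIdeal
  let _ : ∀ M, Field (k M) := fun M => Ideal.Quotient.field _
  let f : A →ₐ[F] ∀ M, k M := AlgHom.pi fun M => Ideal.Quotient.mkₐ F M.asIdeal
  have hf : Function.Surjective f := by
    intro x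
    obtain ⟨r, hr⟩ := Ideal.pi_quotient_surjective (I := fun M : MaximalSpectrum A => M.asIdeal)
      (fun M M' h => Ideal.isCoprime_of_isMaximal fun e => h (MaximalSpectrum.ext e)) x
    exact ⟨r, funext hr⟩
  have hker : ∀ x, f x = 0 → x ∈ nilradical A := by
    intro x hx
    rw [IsArtinianRing.nilradical_eq_iInf, Ideal.mem_iInf]
    intro M
    exact Ideal.Quotient.eq_zero_iff_mem.1 (congrFun hx M)
  have : ∀ M, FiniteDimensional F (k M) := fun M =>
    inferInstanceAs (FiniteDimensional F (A ⧸ M.asIdeal))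
  have := Fintype.ofFinite (MaximalSpectrum A)
  have hJ : Nat.card (MaximalSpectrum A) ≤ 2 ^ l := by
    refine le_trans ?_ hl
    refine le_trans ?_ (LinearMap.finrank_le_finrank_of_surjective (f := f.toLinearMap) hf)
    rw [finrank_pi_fintype, Nat.card_eq_fintype_card, ← Finset.card_univ, Finset.card_eq_sum_ones]
    exact Finset.sum_le_sum fun M _ => finrank_pos
  obtain ⟨g, hg⟩ := exists_adjoin_pi_eq_top (F := F) k hJ
  choose g' hg' using fun t => hf (g t)
  refine ⟨g', fun x => ?_⟩
  have hx : f x ∈ (Algebra.adjoin F (Set.range g')).map f := by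
    rw [AlgHom.map_adjoin, ← Set.range_comp, show f ∘ g' = g from funext hg', hg]
    trivial
  obtain ⟨y, hy, hxy⟩ := hx
  exact ⟨y, hy, hker _ (by rw [map_sub]; exact sub_eq_zero.2 hxy.symm)⟩

/-! ### Generation by operators and recognition of isomorphisms -/

/-- Let `N` be a nilpotent ideal and `S` a subspace stable under a subset `U` of `N`. If `S` and the
products `u * x` with `u ∈ U`, `x ∈ N` together span a space containing `N`, then so does `S`. -/
theorem le_of_le_sup_of_isNilpotent {F A : Type*} [Field F] [CommRing A] [Algebra F A]
    (N : Ideal A) (hN : IsNilpotent N) (U : Set A) (hU : U ⊆ N) (S : Submodule F A)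
    (hS : ∀ u ∈ U, ∀ x ∈ S, u * x ∈ S)
    (h : ∀ T : Submodule F A, S ≤ T → (∀ u ∈ U, ∀ x ∈ N, u * x ∈ T) → N.restrictScalars F ≤ T) :
    N.restrictScalars F ≤ S := by
  have key : ∀ k : ℕ, N.restrictScalars F ≤ S ⊔ (N ^ k).restrictScalars F := by
    intro k
    induction k with
    | zero => intro x _; exact Submodule.mem_sup_right (by simp)
    | succ k ih =>
      refine h _ le_sup_left fun u hu x hx => ?_
      obtain ⟨y, hy, z, hz, rfl⟩ := Submodule.mem_sup.1 (ih hx)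
      rw [mul_add]
      refine add_mem (Submodule.mem_sup_left (hS u hu y hy)) (Submodule.mem_sup_right ?_)
      change u * z ∈ N ^ (k + 1)
      rw [pow_succ']
      exact Ideal.mul_mem_mul (hU hu) hz
  obtain ⟨k, hk⟩ := hN
  have := key k
  rw [hk] at this
  simpa using this

/-- A linear equivalence intertwining enough multiplication operators and multiplicative on a
generating set of the module they act on is an isomorphism of algebras. -/
theorem nonempty_algEquiv_of_intertwine {F A B κ : Type*} [Field F] [CommRing A] [Algebra F A]
    [CommRing B] [Algebra F B] (e : A ≃ₗ[F] B) (u : κ → A) (u' : κ → B)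
    (hu : ∀ r x, e (u r * x) = u' r * e x) (X : Set A) (h1 : e 1 = 1)
    (hX : ∀ x ∈ X, ∀ y ∈ X, e (x * y) = e x * e y)
    (hgen : ∀ S : Submodule F A, 1 ∈ S → X ⊆ S → (∀ r, ∀ x ∈ S, u r * x ∈ S) → S = ⊤) :
    Nonempty (A ≃ₐ[F] B) := by
  -- For fixed `y`, the `x` with `e (x * y) = e x * e y` form a subspace stable under the `u r`.
  -- This is applied first for `y ∈ X`, then, by commutativity, for all `y`.
  have ext : ∀ y, e (1 * y) = e 1 * e y → (∀ x ∈ X, e (x * y) = e x * e y) →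
      ∀ x, e (x * y) = e x * e y := by
    intro y hy1 hy x
    let S : Submodule F A := LinearMap.eqLocus
      (e.toLinearMap ∘ₗ LinearMap.mulRight F y) (LinearMap.mulRight F (e y) ∘ₗ e.toLinearMap)
    have hS : S = ⊤ := by
      refine hgen S hy1 hy fun r x hx => ?_
      have hx : e (x * y) = e x * e y := hx
      change e (u r * x * y) = e (u r * x) * e y
      rw [mul_assoc, hu, hx, hu, mul_assoc]
    exact (hS ▸ Submodule.mem_top : x ∈ S)
  have h2 : ∀ y ∈ X, ∀ x, e (x * y) = e x * e y := fun y hy =>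
    ext y (by rw [h1, one_mul, one_mul]) fun x hx => hX x hx y hy
  exact ⟨AlgEquiv.ofLinearEquiv e h1 fun x y => ext y (by rw [h1, one_mul, one_mul])
    (fun x hx => by rw [mul_comm, h2 x hx, mul_comm]) x⟩


/-! ### Encoding an algebra by a datum -/

theorem Finset.exists_subset_range_of_card_le {α : Type*} (U : Finset α) {r : ℕ} (h : U.card ≤ r)
    (a : α) : ∃ w : Fin r → α, ∀ v ∈ U, ∃ i, w i = v := by
  obtain ⟨φ⟩ : Nonempty (U ↪ Fin r) := Function.Embedding.nonempty_of_card_le (by simpa using h)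
  exact ⟨Function.extend φ Subtype.val fun _ => a, fun v hv =>
    ⟨φ ⟨v, hv⟩, φ.injective.extend_apply _ _ _⟩⟩

/-- The parameters that determine a commutative algebra with a basis adapted to a chain
`I ⊆ N ⊆ A`, where `dim N / I = D`, `dim I = m` and `dim A / N = k`: some multiplication operators,
the unit, products in `N / I` lying in the span of `s` vectors for each left factor, and the
components in `I` of these products. -/
abbrev AlgebraDatum (F : Type u) (κ : Type) (s D m k : ℕ) : Type u :=
  (κ → (Fin D ⊕ Fin m) ⊕ Fin k → (Fin D ⊕ Fin m) ⊕ Fin k → F) ×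
    ((Fin D ⊕ Fin m) ⊕ Fin k → F) × (Fin D → Fin s → Fin D → F) × (Fin D → Fin D → Fin s → F) ×
    (Sym2 (Fin D) → Fin m → F)

/-- The datum `d` describes the algebra `A` in the basis `b`, with operators `v` under which `1` and
the first `D` basis vectors generate `A`. -/
structure AlgebraDatum.Encodes {F : Type u} [Field F] {κ : Type} {s D m k : ℕ}
    (d : AlgebraDatum F κ s D m k) {A : Type u} [CommRing A] [Algebra F A]
    (b : Basis ((Fin D ⊕ Fin m) ⊕ Fin k) F A) (v : κ → A) : Prop where
  operator : ∀ r i j, b.repr (v r * b i) j = d.1 r i j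
  one : ∀ i, b.repr 1 i = d.2.1 i
  mul_left : ∀ i i' j, b.repr (b (.inl (.inl i)) * b (.inl (.inl i'))) (.inl (.inl j)) =
    ∑ t, d.2.2.2.1 i i' t * d.2.2.1 i t j
  mul_right : ∀ i i' j, b.repr (b (.inl (.inl i)) * b (.inl (.inl i'))) (.inl (.inr j)) =
    d.2.2.2.2 s(i, i') j
  mul_compl : ∀ i i' j, b.repr (b (.inl (.inl i)) * b (.inl (.inl i'))) (.inr j) = 0
  generate : ∀ S : Submodule F A, 1 ∈ S → (∀ i, b (.inl (.inl i)) ∈ S) →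
    (∀ r, ∀ x ∈ S, v r * x ∈ S) → S = ⊤

theorem AlgebraDatum.Encodes.nonempty_algEquiv {F : Type u} [Field F] {κ : Type} {s D m k : ℕ}
    {d : AlgebraDatum F κ s D m k} {A B : Type u} [CommRing A] [Algebra F A] [CommRing B]
    [Algebra F B] {b : Basis ((Fin D ⊕ Fin m) ⊕ Fin k) F A} {v : κ → A}
    {b' : Basis ((Fin D ⊕ Fin m) ⊕ Fin k) F B} {v' : κ → B} (h : d.Encodes b v)
    (h' : d.Encodes b' v') : Nonempty (A ≃ₐ[F] B) := by
  let e : A ≃ₗ[F] B := b.equiv b' (Equiv.refl _)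
  have he : ∀ i, e (b i) = b' i := fun i => by simp [e]
  have hrepr : ∀ x i, b'.repr (e x) i = b.repr x i := by
    intro x i
    simp [e, Basis.equiv]
  have eq_of : ∀ x y, (∀ i, b.repr x i = b'.repr y i) → e x = y := fun x y hxy =>
    b'.repr.injective (Finsupp.ext fun i => by rw [hrepr, hxy])
  refine nonempty_algEquiv_of_intertwine e v v' (fun r x => ?_)
    (Set.range fun i => b (.inl (.inl i))) (eq_of _ _ fun i => by rw [h.one, h'.one]) ?_ ?_
  · have : e.toLinearMap ∘ₗ LinearMap.mulLeft F (v r) =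
        LinearMap.mulLeft F (v' r) ∘ₗ e.toLinearMap := b.ext fun i => by
      simp only [LinearMap.comp_apply, LinearMap.mulLeft_apply, LinearEquiv.coe_coe, he]
      exact eq_of _ _ fun j => by rw [h.operator, h'.operator]
    exact LinearMap.congr_fun this x
  · rintro _ ⟨i, rfl⟩ _ ⟨j, rfl⟩
    simp only [he]
    refine eq_of _ _ ?_
    rintro ((t | t) | t)
    · rw [h.mul_left, h'.mul_left]
    · rw [h.mul_right, h'.mul_right]
    · rw [h.mul_compl, h'.mul_compl]
  · exact fun S h1 hX hS => h.generate S h1 (fun i => hX ⟨i, rfl⟩) hS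

/-- Used twice, for `N = C ⊕ I` and then for `A = N ⊕ K`, to build the adapted basis. -/
theorem exists_basis_sum_of_isCompl {F M ι κ : Type*} [Field F] [AddCommGroup M] [Module F M]
    {p q : Submodule F M} (h : IsCompl p q) (bp : Basis ι F p) (bq : Basis κ F q) :
    ∃ b : Basis (ι ⊕ κ) F M, (∀ i, b (.inl i) = bp i) ∧
      (∀ (x : p) i, b.repr x (.inl i) = bp.repr x i) ∧ (∀ (x : p) j, b.repr x (.inr j) = 0) ∧
      ∀ x, (∀ i, b.repr x (.inl i) = 0) ↔ x ∈ q := by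
  let e := Submodule.prodEquivOfIsCompl p q h
  have hx (x : p) : e.symm (x : M) = (x, 0) :=
    Submodule.prodEquivOfIsCompl_symm_apply_left (h := h) (x := x)
  refine ⟨(bp.prod bq).map e, fun i => by simp [e], fun x i => ?_, fun x j => ?_, fun x => ?_⟩
  · rw [Basis.map_repr, LinearEquiv.trans_apply, hx, Basis.prod_repr_inl]
  · rw [Basis.map_repr, LinearEquiv.trans_apply, hx, Basis.prod_repr_inr, map_zero]
    rfl
  · rw [← Submodule.prodEquivOfIsCompl_symm_apply_fst_eq_zero (p := p) q h]
    simp only [Basis.map_repr, LinearEquiv.trans_apply, Basis.prod_repr_inl]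
    rw [← bp.repr.map_eq_zero_iff, Finsupp.ext_iff]
    rfl

/-- A commutative algebra is generated, as a module over finitely many operators, by `1` and a
complement of `∑ u • N` in its nilradical `N`. -/
theorem eq_top_of_stable_of_isCompl {F A κ : Type*} [Field F] [CommRing A] [Algebra F A]
    (N : Ideal A) (hN : IsNilpotent N) (U : Finset N) (g : κ → A)
    (hg : ∀ x, ∃ y ∈ Algebra.adjoin F (Set.range g), x - y ∈ N) (C : Submodule F N)
    (hC : IsCompl (U.sup fun v => LinearMap.range (Algebra.lsmul F F N (v : A))) C)
    (S : Submodule F A) (h1 : 1 ∈ S) (hCS : C ≤ S.comap (N.subtype.restrictScalars F))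
    (hUS : ∀ v ∈ U, ∀ x ∈ S, (v : A) * x ∈ S) (hgS : ∀ i, ∀ x ∈ S, g i * x ∈ S) : S = ⊤ := by
  have hNS : N.restrictScalars F ≤ S := by
    refine le_of_le_sup_of_isNilpotent N hN (Subtype.val '' (U : Set N)) ?_ S ?_ ?_
    · rintro _ ⟨x, -, rfl⟩
      exact x.2
    · rintro _ ⟨v, hv, rfl⟩ x hx
      exact hUS v hv x hx
    · intro T hST hT x hx
      have hIT : (U.sup fun v => LinearMap.range (Algebra.lsmul F F N (v : A))) ≤
          T.comap (N.subtype.restrictScalars F) := Finset.sup_le fun v hv => by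
        rintro _ ⟨y, rfl⟩
        exact hT v ⟨v, hv, rfl⟩ y y.2
      have := sup_le hIT (hCS.trans (Submodule.comap_mono hST))
      rw [hC.sup_eq_top] at this
      exact this (Submodule.mem_top : (⟨x, hx⟩ : N) ∈ ⊤)
  refine eq_top_iff.2 fun x _ => ?_
  obtain ⟨y, hy, hxy⟩ := hg x
  have hstable : ∀ a ∈ Algebra.adjoin F (Set.range g), ∀ z ∈ S, a * z ∈ S := by
    intro a ha
    induction ha using Algebra.adjoin_induction with
    | mem a ha =>
      obtain ⟨i, rfl⟩ := ha
      exact hgS i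
    | algebraMap r =>
      intro z hz
      rw [← Algebra.smul_def]
      exact S.smul_mem r hz
    | add a b _ _ h h' =>
      intro z hz
      rw [add_mul]
      exact S.add_mem (h z hz) (h' z hz)
    | mul a b _ _ h h' =>
      intro z hz
      rw [mul_assoc]
      exact h _ (h' z hz)
  have hyS : y ∈ S := by simpa using hstable y hy 1 h1
  have := S.add_mem (hNS hxy) hyS
  rwa [sub_add_cancel] at this

theorem exists_encodes {F : Type u} [Field F] [Finite F] (A : Type u) [CommRing A] [Algebra F A]
    [FiniteDimensional F A] (s : ℕ) {l : ℕ} (hl : finrank F A ≤ 2 ^ l) :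
    ∃ D m k : ℕ, D + m + k = finrank F A ∧
      ∃ (d : AlgebraDatum F (Fin (finrank F A / (s + 1)) ⊕ Fin (l + 1)) s D m k)
        (b : Basis ((Fin D ⊕ Fin m) ⊕ Fin k) F A) (v : _ → A), d.Encodes b v := by
  classical
  have : IsArtinianRing A := IsArtinianRing.of_finite F A
  obtain ⟨g, hg⟩ := exists_adjoin_sub_mem_nilradical hl
  have hN : IsNilpotent (nilradical A) := IsArtinianRing.isNilpotent_nilradical
  generalize nilradical A = N at hg hN
  have hinj : Function.Injective (N.subtype.restrictScalars F) := N.subtype_injective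
  have : FiniteDimensional F N := FiniteDimensional.of_injective _ hinj
  have hNA : finrank F N ≤ finrank F A := LinearMap.finrank_le_finrank_of_injective hinj
  obtain ⟨U, hU, hrank⟩ := exists_finset_finrank_sup_le
    (fun v : N => LinearMap.range (Algebra.lsmul F F N (v : A))) s
  obtain ⟨I, hI⟩ : ∃ I, I = U.sup fun v => LinearMap.range (Algebra.lsmul F F N (v : A)) := ⟨_, rfl⟩
  obtain ⟨C, hC⟩ := Submodule.exists_isCompl I
  obtain ⟨K, hK⟩ := Submodule.exists_isCompl (N.restrictScalars F)
  -- Padding the elements of `U` to a family of fixed length makes the index type depend only on `n`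
  -- and `s`.
  obtain ⟨w, hw⟩ := U.exists_subset_range_of_card_le
    ((Nat.le_div_iff_mul_le s.succ_pos).2 (hU.trans hNA)) 0
  obtain ⟨bC⟩ : Nonempty (Basis (Fin (finrank F C)) F C) := ⟨finBasis F C⟩
  obtain ⟨bN, hbC, -, -, hbI⟩ := exists_basis_sum_of_isCompl hC.symm bC (finBasis F I)
  obtain ⟨b, hb, hrepr, hrepr0, -⟩ := exists_basis_sum_of_isCompl hK
    (bN.map ((Submodule.restrictScalarsEquiv F A A N).restrictScalars F).symm) (finBasis F K)
  replace hb : ∀ i, b (.inl i) = (bN i : A) := hb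
  replace hrepr : ∀ (x : N) i, b.repr (x : A) (.inl i) = bN.repr x i := hrepr
  replace hrepr0 : ∀ (x : N) i, b.repr (x : A) (.inr i) = 0 := hrepr0
  -- The projection `N → N / I`, in the coordinates of `C`.
  let p : N →ₗ[F] (Fin (finrank F C) → F) := LinearMap.pi fun j => bN.coord (.inl j)
  have hker : p.ker = I := by
    ext x
    rw [LinearMap.mem_ker, ← hbI, funext_iff]
    rfl
  choose W hW using fun v : N => exists_map_le_span_range p
    (LinearMap.range (Algebra.lsmul F F N (v : A))) (s := s) (by rw [hker, hI]; exact hrank v)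
  have hmul : ∀ i j, ∃ c : Fin s → F, ∑ t, c t • W (bC i) t = p ((bC i : N).1 • (bC j : N)) :=
    fun i j => (Submodule.mem_span_range_iff_exists_fun F).1
      (hW _ (Submodule.mem_map_of_mem ⟨_, rfl⟩))
  choose c hc using hmul
  refine ⟨_, _, _, ?_,
    ⟨fun r i j => b.repr ((Sum.elim (fun t => (w t : A)) g r) * b i) j, fun i => b.repr 1 i,
      fun i => W (bC i), c, Sym2.lift ⟨fun i i' j =>
        b.repr (b (.inl (.inl i)) * b (.inl (.inl i'))) (.inl (.inr j)), fun i i' =>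
          funext fun j => congrArg (fun z => b.repr z (.inl (.inr j))) (mul_comm _ _)⟩⟩,
    b, Sum.elim (fun t => (w t : A)) g, ?_⟩
  · rw [finrank_eq_card_basis b]
    simp
  have hprod : ∀ i i', b (.inl (.inl i)) * b (.inl (.inl i')) =
      (((bC i : N).1 • (bC i' : N) : N) : A) := by
    intro i i'
    rw [hb, hb, hbC, hbC]
    rfl
  refine ⟨fun _ _ _ => rfl, fun _ => rfl, fun i i' j => ?_, fun i i' j => rfl, fun i i' j => ?_,
    fun S h1 hCS hS => eq_top_of_stable_of_isCompl N hN U g hg C (hI ▸ hC) S h1 (fun x hx => ?_)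
      (fun v hv x hx => ?_) fun i => hS (.inr i)⟩
  · rw [hprod, hrepr]
    change p _ j = _
    rw [← hc, Finset.sum_apply]
    rfl
  · rw [hprod, hrepr0]
  · have hx' : x = ∑ i, bC.repr ⟨x, hx⟩ i • bN (.inl i) := by
      conv_lhs => rw [show x = ((⟨x, hx⟩ : C) : N) from rfl, ← bC.sum_repr ⟨x, hx⟩]
      simp only [Submodule.coe_sum, Submodule.coe_smul, hbC]
    rw [hx']
    refine Submodule.sum_mem _ fun i _ => Submodule.smul_mem _ _ ?_
    have h := hCS i
    rw [hb] at h
    exact h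
  · obtain ⟨i, rfl⟩ := hw v hv
    exact hS (.inl i) x hx


/-! ### Counting the data -/

theorem AlgebraDatum.finite {F : Type u} [Finite F] {κ : Type} [Finite κ] {s D m k : ℕ} :
    Finite (AlgebraDatum F κ s D m k) := by
  have h1 : Finite (κ → (Fin D ⊕ Fin m) ⊕ Fin k → (Fin D ⊕ Fin m) ⊕ Fin k → F) := inferInstance
  have h2 : Finite ((Fin D → Fin D → Fin s → F) × (Sym2 (Fin D) → Fin m → F)) := inferInstance
  exact @Finite.instProd _ _ h1 (@Finite.instProd _ _ inferInstance
    (@Finite.instProd _ _ inferInstance h2))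

theorem AlgebraDatum.card {F : Type u} [Finite F] {κ : Type} [Finite κ] {s D m k n : ℕ}
    (hn : D + m + k = n) : Nat.card (AlgebraDatum F κ s D m k) =
      Nat.card F ^ (n * n * Nat.card κ + n + 2 * (D * s * D) + m * (D + 1).choose 2) := by
  have := Fintype.ofFinite κ
  have h : Nat.card (Sym2 (Fin D)) = (D + 1).choose 2 := by
    rw [Nat.card_eq_fintype_card, Sym2.card, Fintype.card_fin]
  have h' : Nat.card ((Fin D ⊕ Fin m) ⊕ Fin k) = n := by simp [hn]
  simp only [Nat.card_prod, Nat.card_fun, h, h', Nat.card_eq_fintype_card (α := Fin _),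
    Fintype.card_fin, ← pow_mul, ← pow_add]
  congr 1
  ring

theorem mul_choose_two_le {D m n : ℕ} (h : D + m ≤ n) :
    m * (D + 1).choose 2 ≤ (2 * n ^ 3 + 27 * n ^ 2) / 27 := by
  rw [Nat.le_div_iff_mul_le (by norm_num)]
  have h2 : (D + 1).choose 2 * 2 = (D + 1) * D := by
    rw [Nat.choose_two_right, Nat.add_sub_cancel]
    exact Nat.div_mul_cancel (Nat.even_mul_pred_self (D + 1)).two_dvd
  obtain ⟨t, rfl⟩ := Nat.exists_eq_add_of_le h
  -- The difference of the two sides is `(D - 2 m) ^ 2 (4 D + m)`, so the extremal case is `D = 2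
  -- m`.
  have h3 : 27 * (D * D * m) ≤ 4 * (D + m) ^ 3 := by
    zify
    nlinarith [mul_nonneg (add_nonneg (Int.natCast_nonneg D) (mul_nonneg (by norm_num : (0:ℤ) ≤ 4)
      (Int.natCast_nonneg m))) (sq_nonneg ((D : ℤ) - 2 * m))]
  have h4 : (D + m) ^ 3 ≤ (D + m + t) ^ 3 := Nat.pow_le_pow_left (Nat.le_add_right _ _) 3
  have h5 : D * m ≤ (D + m + t) ^ 2 := by nlinarith [Nat.zero_le (D * t), Nat.zero_le (m * t)]
  nlinarith

/-- The number of classes of rank-`n` algebras over a finite field is bounded by the number of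
data encoding such an algebra. -/
theorem finite_and_card_rankAlgebraClasses_le (F : Type u) [Field F] [Finite F] (n s l : ℕ)
    (hl : n ≤ 2 ^ l) : Finite (RankAlgebraClasses F n) ∧
      Nat.card (RankAlgebraClasses F n) ≤ Nat.card F ^
        (3 * n + (n * n * (n / (s + 1) + (l + 1)) + n + 2 * (n * s * n) +
          (2 * n ^ 3 + 27 * n ^ 2) / 27)) := by
  classical
  let P := {p : Fin (n + 1) × Fin (n + 1) × Fin (n + 1) // p.1.1 + p.2.1.1 + p.2.2.1 = n}
  let T : P → Type u := fun p =>
    AlgebraDatum F (Fin (n / (s + 1)) ⊕ Fin (l + 1)) s p.1.1 p.1.2.1 p.1.2.2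
  have hex : ∀ c : RankAlgebraClasses F n, ∃ t : Σ p, T p,
      ∃ (b : Basis _ F c.out.1) (v : _ → c.out.1), t.2.Encodes b v := by
    intro c
    have : Module.Finite F c.out.1 := c.out.2.1
    have hA : finrank F c.out.1 = n := c.out.2.2
    have h := exists_encodes c.out.1 s (hA.le.trans hl)
    rw [hA] at h
    obtain ⟨D, m, k, hn, d, h⟩ := h
    exact ⟨⟨⟨⟨⟨D, by omega⟩, ⟨m, by omega⟩, ⟨k, by omega⟩⟩, hn⟩, d⟩, h⟩
  choose φ hφ using hex
  have hinj : Function.Injective φ := by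
    intro c c' h
    obtain ⟨b, v, hb⟩ := hφ c
    obtain ⟨b', v', hb'⟩ := hφ c'
    generalize φ c = t at *
    subst h
    rw [← c.out_eq, ← c'.out_eq]
    exact Quotient.sound (hb.nonempty_algEquiv hb')
  have : Finite P := inferInstance
  have : ∀ p, Finite (T p) := fun p => AlgebraDatum.finite
  have := Fintype.ofFinite P
  refine ⟨Finite.of_injective φ hinj, (Nat.card_le_card_of_injective φ hinj).trans ?_⟩
  have hq : 2 ≤ Nat.card F := Finite.one_lt_card
  have hT : ∀ p, Nat.card (T p) ≤ Nat.card F ^ (n * n * (n / (s + 1) + (l + 1)) + n +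
      2 * (n * s * n) + (2 * n ^ 3 + 27 * n ^ 2) / 27) := by
    rintro ⟨⟨⟨D, hD⟩, ⟨m, hm⟩, ⟨k, hk⟩⟩, hn⟩
    replace hn : D + m + k = n := hn
    change Nat.card (AlgebraDatum F _ s D m k) ≤ _
    rw [AlgebraDatum.card hn]
    refine Nat.pow_le_pow_right (by omega) ?_
    have hDn : D ≤ n := by omega
    have h1 := mul_choose_two_le (show D + m ≤ n by omega)
    have h2 : D * s * D ≤ n * s * n := by gcongr
    simp only [Nat.card_sum, Nat.card_eq_fintype_card (α := Fin _), Fintype.card_fin]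
    omega
  -- There are at most `(n + 1) ^ 3` triples of dimensions, and `n + 1 ≤ 2 ^ n ≤ q ^ n`.
  have hP : Nat.card P ≤ Nat.card F ^ (3 * n) := by
    refine (Finite.card_subtype_le _).trans ?_
    have : n + 1 ≤ Nat.card F ^ n := n.lt_two_pow_self.trans_le (Nat.pow_le_pow_left hq n)
    simp only [Nat.card_prod, Nat.card_eq_fintype_card (α := Fin _), Fintype.card_fin]
    calc _ ≤ Nat.card F ^ n * (Nat.card F ^ n * Nat.card F ^ n) := by gcongr
      _ = _ := by ring
  rw [Nat.card_sigma, pow_add]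
  refine (Finset.sum_le_card_nsmul _ _ _ fun p _ => hT p).trans ?_
  rw [smul_eq_mul, Finset.card_univ, ← Nat.card_eq_fintype_card]
  gcongr


/-! ### Lower bound from symmetric products -/

/-- The space `F ^ d × F ^ e` with the product `F ^ d × F ^ d → F ^ e` of coefficients `β`. -/
def SymProductAlgebra {F : Type u} {d e : ℕ} (_β : Sym2 (Fin d) → Fin e → F) : Type u :=
  (Fin d → F) × (Fin e → F)

namespace SymProductAlgebra

variable {F : Type u} [Field F] {d e : ℕ} (β : Sym2 (Fin d) → Fin e → F)

instance : AddCommGroup (SymProductAlgebra β) :=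
  inferInstanceAs (AddCommGroup ((Fin d → F) × (Fin e → F)))

instance : Module F (SymProductAlgebra β) :=
  inferInstanceAs (Module F ((Fin d → F) × (Fin e → F)))

instance [Finite F] : Finite (SymProductAlgebra β) :=
  inferInstanceAs (Finite ((Fin d → F) × (Fin e → F)))

instance : Module.Finite F (SymProductAlgebra β) :=
  inferInstanceAs (Module.Finite F ((Fin d → F) × (Fin e → F)))

theorem finrank_eq : finrank F (SymProductAlgebra β) = d + e := by
  change finrank F ((Fin d → F) × (Fin e → F)) = _
  simp

instance : Mul (SymProductAlgebra β) :=
  ⟨fun x y => (0, fun t => ∑ i, ∑ j, x.1 i * y.1 j * β s(i, j) t)⟩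

instance : NonUnitalCommRing (SymProductAlgebra β) where
  left_distrib x y z := by
    refine Prod.ext (add_zero _).symm (funext fun t => ?_)
    change ∑ i, ∑ j, x.1 i * (y.1 j + z.1 j) * β s(i, j) t =
      ∑ i, ∑ j, x.1 i * y.1 j * β s(i, j) t + ∑ i, ∑ j, x.1 i * z.1 j * β s(i, j) t
    simp only [mul_add, add_mul, Finset.sum_add_distrib]
  right_distrib x y z := by
    refine Prod.ext (add_zero _).symm (funext fun t => ?_)
    change ∑ i, ∑ j, (x.1 i + y.1 i) * z.1 j * β s(i, j) t =
      ∑ i, ∑ j, x.1 i * z.1 j * β s(i, j) t + ∑ i, ∑ j, y.1 i * z.1 j * β s(i, j) t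
    simp only [add_mul, Finset.sum_add_distrib]
  zero_mul x := Prod.ext rfl (funext fun t => by
    change ∑ i, ∑ j, (0 : F) * x.1 j * β s(i, j) t = 0
    simp)
  mul_zero x := Prod.ext rfl (funext fun t => by
    change ∑ i, ∑ j, x.1 i * (0 : F) * β s(i, j) t = 0
    simp)
  -- Both triple products vanish: a product has no component in `F ^ d`, and only that component
  -- enters multiplication.
  mul_assoc x y z := Prod.ext rfl (funext fun t => by
    change ∑ i, ∑ j, (0 : F) * z.1 j * β s(i, j) t = ∑ i, ∑ j, x.1 i * (0 : F) * β s(i, j) t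
    simp)
  mul_comm x y := Prod.ext rfl (funext fun t => by
    change ∑ i, ∑ j, x.1 i * y.1 j * β s(i, j) t = ∑ i, ∑ j, y.1 i * x.1 j * β s(i, j) t
    rw [Finset.sum_comm]
    exact Finset.sum_congr rfl fun i _ => Finset.sum_congr rfl fun j _ => by
      rw [mul_comm (x.1 j), Sym2.eq_swap])

instance : IsScalarTower F (SymProductAlgebra β) (SymProductAlgebra β) :=
  ⟨fun r x y => Prod.ext (smul_zero r).symm (funext fun t => by
    change ∑ i, ∑ j, (r * x.1 i) * y.1 j * β s(i, j) t =
      r * ∑ i, ∑ j, x.1 i * y.1 j * β s(i, j) t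
    simp only [Finset.mul_sum, mul_assoc])⟩

instance : SMulCommClass F (SymProductAlgebra β) (SymProductAlgebra β) :=
  ⟨fun r x y => by
    change r • (x * y) = x * (r • y)
    rw [mul_comm x y, mul_comm x, smul_mul_assoc]⟩

end SymProductAlgebra

open SymProductAlgebra

section

variable {F : Type u} [Field F] {d e : ℕ}

/-- The coordinates on the unitization of `SymProductAlgebra`. -/
def symProductLinearEquiv (β : Sym2 (Fin d) → Fin e → F) :
    Unitization F (SymProductAlgebra β) ≃ₗ[F] F × (Fin d → F) × (Fin e → F) :=
  Unitization.linearEquiv F F _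

/-- The unital algebra `F × F ^ d × F ^ e` obtained by adjoining a unit to `SymProductAlgebra`. -/
def symProductRankAlgebra (β : Sym2 (Fin d) → Fin e → F) : RankAlgebra F (1 + d + e) :=
  ⟨CommAlgCat.of F (Unitization F (SymProductAlgebra β)),
    Module.Finite.equiv (symProductLinearEquiv β).symm, by
      change finrank F (Unitization F (SymProductAlgebra β)) = _
      rw [(symProductLinearEquiv β).finrank_eq]
      simp [add_assoc]⟩

theorem symProductLinearEquiv_symm_mul [DecidableEq (Fin d)] (β : Sym2 (Fin d) → Fin e → F)
    (i j : Fin d) : (symProductLinearEquiv β).symm (0, Pi.single i 1, 0) *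
      (symProductLinearEquiv β).symm (0, Pi.single j 1, 0) =
        (symProductLinearEquiv β).symm (0, 0, β s(i, j)) := by
  let y (i : Fin d) : SymProductAlgebra β := (Pi.single i 1, 0)
  let z : SymProductAlgebra β := (0, β s(i, j))
  change Unitization.inr (R := F) (y i) * Unitization.inr (R := F) (y j) =
    Unitization.inr (R := F) z
  rw [← Unitization.inr_mul]
  congr 1
  refine Prod.ext rfl (funext fun t => ?_)
  change ∑ i', ∑ j', (Pi.single i 1 : Fin d → F) i' * (Pi.single j 1 : Fin d → F) j' *
    β s(i', j') t = β s(i, j) t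
  rw [Finset.sum_eq_single i, Finset.sum_eq_single j] <;> simp +contextual [Pi.single_apply]

/-- The coefficients `β` are the products of the standard vectors, so they can be read off in `A`
from the coordinate map alone. -/
theorem eq_of_algEquiv_eq {A : Type*} [CommRing A] [Algebra F A]
    {β β' : Sym2 (Fin d) → Fin e → F} (f : Unitization F (SymProductAlgebra β) ≃ₐ[F] A)
    (f' : Unitization F (SymProductAlgebra β') ≃ₐ[F] A)
    (h : ∀ x, f ((symProductLinearEquiv β).symm x) = f' ((symProductLinearEquiv β').symm x)) :
    β = β' := by
  classical
  funext z
  induction z using Sym2.ind with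
  | h i j =>
    have h1 := congrArg f (symProductLinearEquiv_symm_mul β i j)
    rw [map_mul, h, h, h, ← map_mul, symProductLinearEquiv_symm_mul] at h1
    have := (symProductLinearEquiv β').symm.injective (f'.injective h1)
    exact (congrArg (fun x => x.2.2) this).symm

/-- Each algebra is the algebra of at most `q ^ (n * n)` symmetric products. -/
theorem card_le_card_rankAlgebraClasses_mul [Finite F] [Finite (RankAlgebraClasses F (1 + d + e))] :
    Nat.card F ^ (e * (d + 1).choose 2) ≤
      Nat.card (RankAlgebraClasses F (1 + d + e)) * Nat.card F ^ ((1 + d + e) * (1 + d + e)) := by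
  let M := F × (Fin d → F) × (Fin e → F)
  have hM : finrank F M = 1 + d + e := by simp [M, add_assoc]
  let c : (Sym2 (Fin d) → Fin e → F) → RankAlgebraClasses F (1 + d + e) := fun β =>
    Quotient.mk _ (symProductRankAlgebra β)
  have hf : ∀ β, Nonempty (Unitization F (SymProductAlgebra β) ≃ₐ[F] (c β).out.1) := fun β =>
    Quotient.exact (s := rankAlgebraSetoid F (1 + d + e)) (c β).out_eq.symm
  obtain ⟨f⟩ := Classical.nonempty_pi.2 hf
  have hτ : ∀ x : RankAlgebraClasses F (1 + d + e), Nonempty (x.out.1 ≃ₗ[F] M) := by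
    intro x
    have := x.out.2.1
    exact FiniteDimensional.nonempty_linearEquiv_of_finrank_eq (x.out.2.2.trans hM.symm)
  obtain ⟨τ⟩ := Classical.nonempty_pi.2 hτ
  -- The class together with a linear endomorphism of the fixed space `M` recovers `β`; there are `q
  -- ^ (n * n)` endomorphisms.
  let Φ : (Sym2 (Fin d) → Fin e → F) → RankAlgebraClasses F (1 + d + e) × (M →ₗ[F] M) := fun β =>
    (c β, (τ (c β)).toLinearMap ∘ₗ (f β).toLinearMap ∘ₗ (symProductLinearEquiv β).symm.toLinearMap)
  have hΦ : Function.Injective Φ := by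
    intro β β' h
    obtain ⟨h1, h2⟩ := Prod.ext_iff.1 h
    have h2 : ∀ x, τ (c β) (f β ((symProductLinearEquiv β).symm x)) =
        τ (c β') (f β' ((symProductLinearEquiv β').symm x)) := LinearMap.congr_fun h2
    have h1 : c β = c β' := h1
    generalize f β = g at h2
    generalize f β' = g' at h2
    generalize c β = x at h1 g h2
    subst h1
    exact eq_of_algEquiv_eq g g' fun x => (τ _).injective (h2 x)
  have : Finite (M →ₗ[F] M) := Module.finite_of_finite F
  have h := Nat.card_le_card_of_injective Φ hΦ
  rw [Nat.card_prod, Module.natCard_eq_pow_finrank (K := F) (V := M →ₗ[F] M),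
    finrank_linearMap, hM] at h
  refine le_of_eq_of_le ?_ h
  simp only [Nat.card_fun, Nat.card_eq_fintype_card (α := Fin _), Nat.card_eq_fintype_card
    (α := Sym2 _), Sym2.card, Fintype.card_fin, ← pow_mul]

end


/-! ### Estimates of the exponents and conclusion -/

theorem cube_root_bounds (n : ℕ) (hn : n ≠ 0) : ∃ x : ℝ, 1 ≤ x ∧ (n : ℝ) = x ^ 3 ∧
    (n : ℝ) ^ (8 / 3 : ℝ) = x ^ 8 := by
  have h0 : (0 : ℝ) ≤ n := n.cast_nonneg
  refine ⟨(n : ℝ) ^ (1 / 3 : ℝ), Real.one_le_rpow ?_ (by norm_num), ?_, ?_⟩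
  · exact_mod_cast Nat.one_le_iff_ne_zero.2 hn
  · rw [← Real.rpow_natCast, ← Real.rpow_mul h0]
    norm_num
  · rw [← Real.rpow_natCast, ← Real.rpow_mul h0]
    norm_num

theorem exists_card_exponent_le (n : ℕ) : ∃ s l : ℕ, n ≤ 2 ^ l ∧
    ((3 * n + (n * n * (n / (s + 1) + (l + 1)) + n + 2 * (n * s * n) +
      (2 * n ^ 3 + 27 * n ^ 2) / 27) : ℕ) : ℝ) ≤
        2 / 27 * (n : ℝ) ^ 3 + 12 * (n : ℝ) ^ (8 / 3 : ℝ) := by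
  rcases eq_or_ne n 0 with rfl | hn
  · refine ⟨0, 0, by norm_num, ?_⟩
    norm_num
  obtain ⟨x, hx, hnx, h8⟩ := cube_root_bounds n hn
  have hx0 : 0 ≤ x := zero_le_one.trans hx
  have hs : (⌊x⌋₊ : ℝ) ≤ x := Nat.floor_le hx0
  have hs' : x ≤ ⌊x⌋₊ + 1 := (Nat.lt_floor_add_one x).le
  generalize ⌊x⌋₊ = s at hs hs'
  -- With `s = ⌊n ^ (1/3)⌋`, one has `n ≤ (s + 1) ^ 3 ≤ 2 ^ (3 s)`.
  refine ⟨s, 3 * s, ?_, ?_⟩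
  · have h1 : (n : ℝ) ≤ ((s + 1 : ℕ) : ℝ) ^ 3 := by
      rw [hnx]
      push_cast
      gcongr
    have h2 : n ≤ (s + 1) ^ 3 := by exact_mod_cast h1
    rw [mul_comm 3 s, pow_mul]
    exact h2.trans (Nat.pow_le_pow_left s.lt_two_pow_self 3)
  · have hdiv : ((n / (s + 1) : ℕ) : ℝ) ≤ x ^ 2 := by
      refine Nat.cast_div_le.trans ?_
      rw [div_le_iff₀ (by positivity), hnx]
      push_cast
      calc x ^ 3 = x ^ 2 * x := by ring
        _ ≤ _ := by gcongr
    have hM : (((2 * n ^ 3 + 27 * n ^ 2) / 27 : ℕ) : ℝ) ≤ 2 / 27 * (n : ℝ) ^ 3 + (n : ℝ) ^ 2 := by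
      refine Nat.cast_div_le.trans (le_of_eq ?_)
      push_cast
      ring
    have e (k : ℕ) (hk : k ≤ 8) : x ^ k ≤ x ^ 8 := pow_le_pow_right₀ hx hk
    rw [h8]
    push_cast at hM hdiv ⊢
    calc _ ≤ 3 * (n : ℝ) + (n * n * (x ^ 2 + (3 * x + 1)) + n + 2 * (n * x * n) +
          (2 / 27 * (n : ℝ) ^ 3 + (n : ℝ) ^ 2)) := by gcongr
      _ = 2 / 27 * (n : ℝ) ^ 3 + (4 * x ^ 3 + x ^ 8 + 5 * x ^ 7 + 2 * x ^ 6) := by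
        rw [hnx]; ring
      _ ≤ _ := by
        have := e 3 (by norm_num)
        have := e 7 (by norm_num)
        have := e 6 (by norm_num)
        linarith

theorem exists_le_mul_choose_two (n : ℕ) (hn : n ≠ 0) : ∃ d e : ℕ, n = 1 + d + e ∧
    2 / 27 * (n : ℝ) ^ 3 - 2 * (n : ℝ) ^ 2 ≤
      ((e * (d + 1).choose 2 : ℕ) : ℝ) - (((1 + d + e) * (1 + d + e) : ℕ) : ℝ) := by
  -- One dimension is the unit; the other `n - 1` are split as nearly as possible in the optimal
  -- ratio `d : e = 2 : 1`.
  obtain ⟨a, j, hj, rfl⟩ : ∃ a j, j < 3 ∧ n = 1 + (3 * a + j) :=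
    ⟨(n - 1) / 3, (n - 1) % 3, Nat.mod_lt _ (by norm_num), by omega⟩
  refine ⟨2 * a, a + j, by ring, ?_⟩
  have h : (((2 * a + 1).choose 2 : ℕ) : ℝ) = (2 * a + 1) * a := by
    rw [Nat.cast_choose_two]
    push_cast
    ring
  have ha : (0 : ℝ) ≤ a := a.cast_nonneg
  rw [Nat.cast_mul, h]
  push_cast
  interval_cases j <;> push_cast <;> nlinarith [mul_nonneg ha ha]

theorem mainTheorem2 :
    ∃ C : ℝ, 0 < C ∧ ∀ (F : Type u) [Field F] [Finite F] (n : ℕ),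
      Finite (RankAlgebraClasses F n) ∧
      (Nat.card F : ℝ) ^ ((2 / 27 : ℝ) * (n : ℝ) ^ 3 - C * (n : ℝ) ^ (8 / 3 : ℝ))
        ≤ (Nat.card (RankAlgebraClasses F n) : ℝ) ∧
      (Nat.card (RankAlgebraClasses F n) : ℝ)
        ≤ (Nat.card F : ℝ) ^ ((2 / 27 : ℝ) * (n : ℝ) ^ 3 + C * (n : ℝ) ^ (8 / 3 : ℝ)) := by
  -- With `x = n ^ (1/3)`, the upper error is `x ^ 8 + 5 x ^ 7 + 2 x ^ 6 + 4 x ^ 3 ≤ 12 x ^ 8`; the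
  -- lower bound needs only `2 x ^ 6`.
  refine ⟨12, by norm_num, fun F _ _ n => ?_⟩
  have hq : (1 : ℝ) ≤ Nat.card F := by exact_mod_cast Nat.card_pos (α := F)
  have hq0 : (0 : ℝ) < Nat.card F := zero_lt_one.trans_le hq
  obtain ⟨s, l, hl, hE⟩ := exists_card_exponent_le n
  obtain ⟨hfin, hcard⟩ := finite_and_card_rankAlgebraClasses_le F n s l hl
  refine ⟨hfin, ?_, ?_⟩
  -- The construction needs `n ≥ 1` for its unit. For `n = 0` the lower bound is `1`, witnessed by
  -- the zero algebra.
  · rcases eq_or_ne n 0 with rfl | hn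
    · have : Nonempty (RankAlgebraClasses F 0) :=
        ⟨Quotient.mk _ ⟨CommAlgCat.of F PUnit.{u + 1}, inferInstanceAs (Module.Finite F PUnit.{u + 1}),
          finrank_zero_of_subsingleton (R := F) (M := PUnit.{u + 1})⟩⟩
      have h1 : (1 : ℝ) ≤ Nat.card (RankAlgebraClasses F 0) := by
        exact_mod_cast Nat.card_pos (α := RankAlgebraClasses F 0)
      simpa using h1
    · obtain ⟨x, hx, hnx, h8⟩ := cube_root_bounds n hn
      obtain ⟨d, e, rfl, hde⟩ := exists_le_mul_choose_two n hn
      have hle : (2 / 27 : ℝ) * ((1 + d + e : ℕ) : ℝ) ^ 3 -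
          12 * ((1 + d + e : ℕ) : ℝ) ^ (8 / 3 : ℝ) ≤
          ((e * (d + 1).choose 2 : ℕ) : ℝ) - (((1 + d + e) * (1 + d + e) : ℕ) : ℝ) := by
        refine le_trans ?_ hde
        have h6 : ((1 + d + e : ℕ) : ℝ) ^ 2 ≤ x ^ 8 := by
          rw [hnx, ← pow_mul]
          exact pow_le_pow_right₀ hx (by norm_num)
        have : 0 ≤ x ^ 8 := by positivity
        rw [h8]
        linarith
      refine (Real.rpow_le_rpow_of_exponent_le hq hle).trans ?_
      rw [Real.rpow_sub hq0, div_le_iff₀ (by positivity), Real.rpow_natCast, Real.rpow_natCast]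
      exact_mod_cast card_le_card_rankAlgebraClasses_mul (F := F) (d := d) (e := e)
  · refine le_trans ?_ (Real.rpow_le_rpow_of_exponent_le hq hE)
    rw [Real.rpow_natCast]
    exact_mod_cast hcard
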